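/- **Conventions.** All spaces are Hausdorff. A family of subsets of a topological space $X$ is $\sigma$-locally finite if it is a countable union of locally finite families. A family $\mathcal N$ of subsets of $X$ is - a *$k$-network* if whenever $K\subseteq U$ with $K$ compact and $U$ open, there is a finite $\mathcal F\subseteq\mathcal N$ with $K\subseteq\bigcup\mathcal F\subseteq U$; - a *$cn$-network* if for every $x\in X$ and every neighborhood $O$ of $x$ the set $\bigcup\{N\in\mathcal N: x\in N\subseteq O\}$ is a neighborhood of $x$; - a *$ck$-network* if for every $x\in X$ and every neighborhood $O$ of $x$ there is a neighborhood $U$ of $x$ such that for each compact $K\subseteq U$ there is a finite $\mathcal F\subseteq\mathcal N$ with $x\in\bigcap\mathcal F$ and $K\subseteq\bigcup\mathcal F\subseteq O$ (where $\bigcap\emptyset=X$); - a *$cp$-network* if $\{x\}\in\mathcal N$ for every isolated point $x$, and for every non-isolated $x\in X$, every $A\subseteq X$ with $x\in\overline A\setminus A$ and every neighborhood $O$ of $x$ there is $N\in\mathcal N$ with $x\in N\subseteq O$ and $N\cap A$ infinite. A regular space is a *$\mathfrak P$-space*, an *$\aleph$-space*, a *strict $\aleph$-space*, a *strict $\sigma$-space*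 if it has a $\sigma$-locally finite $cp$-network, $k$-network, $ck$-network, $cn$-network, respectively. $X$ has *countable fan tightness* if for all $x\in X$ and $A_n\subseteq X$ $(n\in\mathbb N)$ with $x\in\bigcap_n\overline{A_n}$ there are finite $F_n\subseteq A_n$ with $x\in\overline{\bigcup_n F_n}$. $X$ is *Fréchet–Urysohn* if every point of the closure of a set $A\subseteq X$ is the limit of a sequence in $A$. $X$ has *property $(\alpha_4)$* if whenever $\lim_n x_{m,n}=x$ for every $m\in\mathbb N$, there are a sequence $(m_k)$ of distinct natural numbers and a sequence $(n_k)$ of natural numbers with $\lim_k x_{m_k,n_k}=x$. $X$ is an *$M$-space* if there are open covers $\mathcal U_n$ $(n\in\mathbb N)$ of $X$ such that (a) if $x\in X$ and $x_n\in\bigcup\{U\in\mathcal U_n: x\in U\}$ for every $n$, then the sequence $(x_n)$ has a cluster point; (b) for every $n$ and every $V\in\mathcal U_{n+1}$, the union of all members of $\mathcal U_{n+1}$ meeting $V$ is contained in some member of $\mathcal U_n$. **Theorem 4.4.** For a Hausdorff topological space $X$ the following assertions are equivalent: 1. $X$ is metrizable; 2. $X$ is a $\mathfrak P$-space and has countable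 fan tightness; 3. $X$ is an $\aleph$-space, is Fréchet–Urysohn and has property $(\alpha_4)$; 4. $X$ is a strict $\aleph$-space, is Fréchet–Urysohn and has property $(\alpha_4)$; 5. $X$ is a strict $\sigma$-space and an $M$-space. -/

import Mathlib

open Set Filter Topology

/-! ### Families of subsets of a topological space -/

/-- A family `𝒩` of subsets of `X` is σ-locally finite if it is a countable union of locally
finite families. -/
def IsSigmaLocallyFinite {X : Type*} [TopologicalSpace X] (𝒩 : Set (Set X)) : Prop :=
  ∃ 𝒟 : ℕ → Set (Set X), 𝒩 = ⋃ n, 𝒟 n ∧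
    ∀ n, LocallyFinite (fun N : 𝒟 n => (N : Set X))

/-- `𝒩` is a *k-network* in `X`: whenever `K ⊆ U` with `K` compact and `U` open, there is a finite
`ℱ ⊆ 𝒩` with `K ⊆ ⋃ ℱ ⊆ U`. -/
def IsKNetwork {X : Type*} [TopologicalSpace X] (𝒩 : Set (Set X)) : Prop :=
  ∀ K U : Set X, IsCompact K → IsOpen U → K ⊆ U →
    ∃ ℱ : Set (Set X), ℱ ⊆ 𝒩 ∧ ℱ.Finite ∧ K ⊆ ⋃₀ ℱ ∧ ⋃₀ ℱ ⊆ U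

/-- `𝒩` is a *cn-network* at `x`: for each neighborhood `O` of `x`, the union of all `N ∈ 𝒩` with
`x ∈ N ⊆ O` is a neighborhood of `x`. -/
def IsCnNetworkAt {X : Type*} [TopologicalSpace X] (𝒩 : Set (Set X)) (x : X) : Prop :=
  ∀ O ∈ 𝓝 x, ⋃₀ {N | N ∈ 𝒩 ∧ x ∈ N ∧ N ⊆ O} ∈ 𝓝 x

/-- `𝒩` is a *cn-network* in `X`: it is a cn-network at each point. -/
def IsCnNetwork {X : Type*} [TopologicalSpace X] (𝒩 : Set (Set X)) : Prop :=
  ∀ x : X, IsCnNetworkAt 𝒩 x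

/-- `𝒩` is a *ck-network* at `x`: each neighborhood `O` of `x` admits a neighborhood `U` of `x`
such that for every compact `K ⊆ U` there is a finite `ℱ ⊆ 𝒩` with `x ∈ ⋂ ℱ` and
`K ⊆ ⋃ ℱ ⊆ O`. -/
def IsCkNetworkAt {X : Type*} [TopologicalSpace X] (𝒩 : Set (Set X)) (x : X) : Prop :=
  ∀ O ∈ 𝓝 x, ∃ U ∈ 𝓝 x, ∀ K : Set X, IsCompact K → K ⊆ U →
    ∃ ℱ : Set (Set X), ℱ ⊆ 𝒩 ∧ ℱ.Finite ∧ x ∈ ⋂₀ ℱ ∧ K ⊆ ⋃₀ ℱ ∧ ⋃₀ ℱ ⊆ O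

/-- `𝒩` is a *ck-network* in `X`: it is a ck-network at each point. -/
def IsCkNetwork {X : Type*} [TopologicalSpace X] (𝒩 : Set (Set X)) : Prop :=
  ∀ x : X, IsCkNetworkAt 𝒩 x

/-- `𝒩` is a *cp-network* at `x`: if `x` is isolated, then `{x} ∈ 𝒩`; if `x` is not isolated, then
for each `A ⊆ X` with `x ∈ closure A \ A` and each neighborhood `O` of `x` there is `N ∈ 𝒩` with
`x ∈ N ⊆ O` and `N ∩ A` infinite. -/
def IsCpNetworkAt {X : Type*} [TopologicalSpace X] (𝒩 : Set (Set X)) (x : X) : Prop :=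
  (IsOpen ({x} : Set X) ∧ {x} ∈ 𝒩) ∨
  (¬ IsOpen ({x} : Set X) ∧ ∀ A : Set X, x ∈ closure A \ A → ∀ O ∈ 𝓝 x,
    ∃ N ∈ 𝒩, x ∈ N ∧ N ⊆ O ∧ (N ∩ A).Infinite)

/-- `𝒩` is a *cp-network* in `X`: it is a cp-network at each point. -/
def IsCpNetwork {X : Type*} [TopologicalSpace X] (𝒩 : Set (Set X)) : Prop :=
  ∀ x : X, IsCpNetworkAt 𝒩 x

/-! ### Classes of generalized metric spaces

On Hausdorff spaces, `RegularSpace` amounts to `T3Space`. -/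

/-- A *𝔓-space*: a regular space with a σ-locally finite cp-network. -/
def IsPSpace (X : Type*) [TopologicalSpace X] : Prop :=
  RegularSpace X ∧ ∃ 𝒩 : Set (Set X), IsSigmaLocallyFinite 𝒩 ∧ IsCpNetwork 𝒩

/-- An *ℵ-space*: a regular space with a σ-locally finite k-network. -/
def IsAlephSpace (X : Type*) [TopologicalSpace X] : Prop :=
  RegularSpace X ∧ ∃ 𝒩 : Set (Set X), IsSigmaLocallyFinite 𝒩 ∧ IsKNetwork 𝒩

/-- A *strict ℵ-space*: a regular space with a σ-locally finite ck-network. -/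
def IsStrictAlephSpace (X : Type*) [TopologicalSpace X] : Prop :=
  RegularSpace X ∧ ∃ 𝒩 : Set (Set X), IsSigmaLocallyFinite 𝒩 ∧ IsCkNetwork 𝒩

/-- A *strict σ-space*: a regular space with a σ-locally finite cn-network. -/
def IsStrictSigmaSpace (X : Type*) [TopologicalSpace X] : Prop :=
  RegularSpace X ∧ ∃ 𝒩 : Set (Set X), IsSigmaLocallyFinite 𝒩 ∧ IsCnNetwork 𝒩

/-! ### Further properties -/

/-- Countable fan tightness at every point: if `x ∈ ⋂ n, closure (A n)`, there are finite sets
`F n ⊆ A n` with `x ∈ closure (⋃ n, F n)`. -/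
def HasCountableFanTightness (X : Type*) [TopologicalSpace X] : Prop :=
  ∀ (x : X) (A : ℕ → Set X), (∀ n, x ∈ closure (A n)) →
    ∃ F : ℕ → Set X, (∀ n, (F n).Finite ∧ F n ⊆ A n) ∧ x ∈ closure (⋃ n, F n)

/-- Property (α₄) at every point: if `x m n → x` as `n → ∞` for each `m`, there are pairwise
distinct `m 0, m 1, …` and arbitrary `n 0, n 1, …` with `x (m k) (n k) → x` as `k → ∞`. -/
def HasPropertyAlphaFour (X : Type*) [TopologicalSpace X] : Prop :=
  ∀ (x : X) (u : ℕ → ℕ → X), (∀ m, Tendsto (u m) atTop (𝓝 x)) →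
    ∃ m n : ℕ → ℕ, Function.Injective m ∧ Tendsto (fun k => u (m k) (n k)) atTop (𝓝 x)

/-- The star of a set `S` with respect to the family `𝒰`: the union of all members of `𝒰`
that meet `S`. -/
def setStar {X : Type*} (S : Set X) (𝒰 : Set (Set X)) : Set X :=
  ⋃₀ {U | U ∈ 𝒰 ∧ (U ∩ S).Nonempty}

/-- `𝒱` star refines `𝒰`: the star of every member of `𝒱` with respect to `𝒱` is contained in a
member of `𝒰`. -/
def StarRefines {X : Type*} (𝒱 𝒰 : Set (Set X)) : Prop :=
  ∀ V ∈ 𝒱, ∃ U ∈ 𝒰, setStar V 𝒱 ⊆ U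

/-- An *M-space*: there are open covers `𝒰 n` of `X` such that any sequence `u` with
`u n ∈ ⋃ {U ∈ 𝒰 n | x ∈ U}` for all `n` has a cluster point, and each `𝒰 (n + 1)` star refines
`𝒰 n`. -/
def IsMSpace (X : Type*) [TopologicalSpace X] : Prop :=
  ∃ 𝒰 : ℕ → Set (Set X),
    (∀ n, (∀ U ∈ 𝒰 n, IsOpen U) ∧ ⋃₀ 𝒰 n = univ) ∧
    (∀ (x : X) (u : ℕ → X), (∀ n, u n ∈ ⋃₀ {U | U ∈ 𝒰 n ∧ x ∈ U}) →
      ∃ y : X, MapClusterPt y atTop u) ∧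
    ∀ n, StarRefines (𝒰 (n + 1)) (𝒰 n)

/-! A metrizable space has a σ-locally finite base, and such a base is a network of all four kinds
at once; first countability and shrinking balls supply the remaining properties.

The converses rest on `pseudoMetrizableSpace_of_locallyFinite`, a consequence of Frink's lemma: it
suffices that, for each neighborhood `O` of `x`, the members contained in `O` and taken from
finitely many levels already unite to a neighborhood of `x`. If this fails, `x` lies in the closure
of the complement of each such union. Fan tightness or (α₄) then diagonalizes through these
complements, giving finite sets or a sequence that accumulate at `x`. A single member of the
cp-network, or finitely many members of the k- or ck-network, must capture points of arbitrarily
high index, although their levels are bounded: a contradiction.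

For M-spaces, the star-refining covers define a coarser pseudometrizable topology over which the
network yields paracompactness. The closed network also separates points by a sequence of relations.
Locally finite closed covers subordinate to both structures have stars shrinking to each point, so
the same criterion applies. -/

/-! ### Metrization by sequences of relations -/

/-- A sequence of symmetric reflexive relations with `E (n + 1) ∘ E (n + 1) ⊆ E n` is a basis of a
pseudometrizable uniformity. -/
theorem exists_pseudoMetrizable_hasBasis {X : Type*} (E : ℕ → X → X → Prop)
    (refl : ∀ n x, E n x x) (symm : ∀ n x y, E n x y → E n y x)
    (comp : ∀ n x y z, E (n + 1) x y → E (n + 1) y z → E n x z) :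
    ∃ t : TopologicalSpace X, @TopologicalSpace.PseudoMetrizableSpace X t ∧
      ∀ x, (@nhds X t x).HasBasis (fun _ : ℕ => True) (fun n => {y | E n x y}) := by
  have anti : ∀ m n, m ≤ n → ∀ x y, E n x y → E m x y := by
    intro m n h
    induction h with
    | refl => exact fun _ _ h => h
    | step _ ih => exact fun x y h => ih x y (comp _ x x y (refl _ x) h)
  have hB : IsBasis (fun _ : ℕ => True) (fun n => {p : X × X | E n p.1 p.2}) :=
    ⟨⟨0, trivial⟩, fun {i j} _ _ => ⟨max i j, trivial, fun p hp =>
      ⟨anti _ _ (le_max_left i j) _ _ hp, anti _ _ (le_max_right i j) _ _ hp⟩⟩⟩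
  let c : UniformSpace.Core X := UniformSpace.Core.mkOfBasis hB.filterBasis
    (by rintro _ ⟨n, _, rfl⟩ x; exact refl n x)
    (by rintro _ ⟨n, _, rfl⟩; exact ⟨_, ⟨n, trivial, rfl⟩, fun p hp => symm n _ _ hp⟩)
    (by
      rintro _ ⟨n, _, rfl⟩
      refine ⟨_, ⟨n + 1, trivial, rfl⟩, ?_⟩
      rintro ⟨x, z⟩ ⟨y, hxy, hyz⟩
      exact comp n x y z hxy hyz)
  let u : UniformSpace X := UniformSpace.ofCore c
  have hb : (uniformity X).HasBasis (fun _ : ℕ => True) (fun n => {p : X × X | E n p.1 p.2}) :=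
    hB.hasBasis
  have : (uniformity X).IsCountablyGenerated :=
    HasCountableBasis.isCountablyGenerated ⟨hb, Set.to_countable _⟩
  exact ⟨u.toTopologicalSpace, inferInstance, fun x => nhds_basis_uniformity' hb⟩

/-- **Frink's metrization lemma**: a space is pseudometrizable if its neighborhood filters are
generated by a decreasing sequence of symmetric relations satisfying the local axiom of the
triangle. -/
theorem pseudoMetrizableSpace_of_local_triangle {X : Type*} [TopologicalSpace X]
    (R : ℕ → X → X → Prop) (symm : ∀ n x y, R n x y → R n y x)
    (anti : ∀ m n, m ≤ n → ∀ x y, R n x y → R m x y)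
    (mem : ∀ n x, {y | R n x y} ∈ 𝓝 x)
    (small : ∀ x, ∀ O ∈ 𝓝 x, ∃ n, ∀ y, R n x y → y ∈ O)
    (triangle : ∀ x n, ∃ m, ∀ y z, R m x y → R m y z → R n x z) :
    TopologicalSpace.PseudoMetrizableSpace X := by
  have refl : ∀ n x, R n x x := fun n x => mem_of_mem_nhds (mem n x)
  have quad : ∀ x k, ∃ m, k < m ∧ ∀ y z w, R m x y → R m y z → R m z w → R k x w := by
    intro x k
    obtain ⟨m, hm⟩ := triangle x k
    obtain ⟨l, hl⟩ := triangle x m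
    refine ⟨max (k + 1) (max l m), by omega, fun y z w h1 h2 h3 => hm z w (hl y z ?_ ?_) ?_⟩
    · exact anti _ _ (by omega) _ _ h1
    · exact anti _ _ (by omega) _ _ h2
    · exact anti _ _ (by omega) _ _ h3
  choose a hlt ha using quad
  -- The scale depends on the center: `μ (n + 1) p` is fine enough that three steps at that scale
  -- starting from `p` stay within scale `μ n p`. Two points are `E n`-close when they lie in a
  -- common ball of scale `μ n z` about some `z`.
  let μ : ℕ → X → ℕ := fun n x => Nat.rec 0 (fun _ k => a x k) n
  have hμ : ∀ n x, μ (n + 1) x = a x (μ n x) := fun n x => rfl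
  have hμle : ∀ n x, n ≤ μ n x := by
    intro n x
    induction n with
    | zero => exact Nat.zero_le _
    | succ n ih => rw [hμ]; exact lt_of_le_of_lt ih (hlt _ _)
  let E : ℕ → X → X → Prop := fun n x y => ∃ z, R (μ n z) z x ∧ R (μ n z) z y
  have Esymm : ∀ n x y, E n x y → E n y x := fun n x y ⟨z, h1, h2⟩ => ⟨z, h2, h1⟩
  -- The center with the coarser scale serves for the composite: the chain `p, y, q, z` has three
  -- steps at the scale of `p`.
  have key : ∀ n x y z p q, R (μ (n + 1) p) p x → R (μ (n + 1) p) p y → R (μ (n + 1) q) q y →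
      R (μ (n + 1) q) q z → μ (n + 1) p ≤ μ (n + 1) q → E n x z := by
    intro n x y z p q h1 h2 h3 h4 hle
    refine ⟨p, anti _ _ (hlt p _).le _ _ h1, ha p (μ n p) y q z h2 ?_ ?_⟩
    · exact anti _ _ hle _ _ (symm _ _ _ h3)
    · exact anti _ _ hle _ _ h4
  obtain ⟨t, ht, hb⟩ := exists_pseudoMetrizable_hasBasis E (fun n x => ⟨x, refl _ x, refl _ x⟩)
    Esymm (by
      rintro n x y z ⟨p, h1, h2⟩ ⟨q, h3, h4⟩
      rcases le_total (μ (n + 1) p) (μ (n + 1) q) with h | h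
      · exact key n x y z p q h1 h2 h3 h4 h
      · exact Esymm _ _ _ (key n z y x q p h4 h3 h2 h1 h))
  convert ht
  refine TopologicalSpace.ext_nhds fun x => Filter.ext fun O => ?_
  rw [(hb x).mem_iff]
  constructor
  · intro hO
    obtain ⟨k, hk⟩ := small x O hO
    obtain ⟨m, hm⟩ := triangle x k
    refine ⟨m, trivial, ?_⟩
    rintro y ⟨z, hzx, hzy⟩
    exact hk y (hm z y (symm _ _ _ (anti _ _ (hμle m z) _ _ hzx)) (anti _ _ (hμle m z) _ _ hzy))
  · rintro ⟨n, -, hn⟩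
    exact mem_of_superset (mem (μ n x) x) fun y hy => hn ⟨x, refl _ x, hy⟩

/-- A space is pseudometrizable if its neighborhood filters are generated by a decreasing sequence
of transitive neighborhood assignments `g n` such that the union of all `g n y` meeting `g n x` is
small for large `n`. -/
theorem pseudoMetrizableSpace_of_transitive_nhds {X : Type*} [TopologicalSpace X]
    (g : ℕ → X → Set X) (mem : ∀ n x, g n x ∈ 𝓝 x) (anti : ∀ m n, m ≤ n → ∀ x, g n x ⊆ g m x)
    (trans : ∀ n x, ∀ y ∈ g n x, g n y ⊆ g n x)
    (small : ∀ x, ∀ O ∈ 𝓝 x, ∃ n, ∀ y, (g n x ∩ g n y).Nonempty → y ∈ O) :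
    TopologicalSpace.PseudoMetrizableSpace X := by
  -- Local triangle: for fine `m`, meeting `g m x` puts `y` inside `g n x`; by transitivity,
  -- whatever meets `g n y` then meets `g n x`.
  refine pseudoMetrizableSpace_of_local_triangle (fun n x y => (g n x ∩ g n y).Nonempty)
    (fun n x y h => by rwa [inter_comm]) (fun m n h x y => ?_) (fun n x => ?_) small fun x n => ?_
  · exact Nonempty.mono (inter_subset_inter (anti m n h x) (anti m n h y))
  · exact mem_of_superset (mem n x) fun y hy => ⟨y, hy, mem_of_mem_nhds (mem n y)⟩
  · obtain ⟨m, hm⟩ := small x (g n x) (mem n x)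
    refine ⟨max m n, fun y z hxy ⟨w, hy, hz⟩ => ⟨w, ?_, anti _ _ (le_max_right m n) _ hz⟩⟩
    have hyx : y ∈ g n x := hm y (hxy.mono
      (inter_subset_inter (anti _ _ (le_max_left m n) _) (anti _ _ (le_max_left m n) _)))
    exact trans n x y hyx (anti _ _ (le_max_right m n) _ hy)

/-! ### Locally finite families of sets -/

theorem locallyFinite_coe_iff {X : Type*} [TopologicalSpace X] {𝒟 : Set (Set X)} :
    LocallyFinite (fun N : 𝒟 => (N : Set X)) ↔
      ∀ x, ∃ V ∈ 𝓝 x, {N | N ∈ 𝒟 ∧ (N ∩ V).Nonempty}.Finite := by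
  refine forall_congr' fun x => exists_congr fun V => and_congr_right fun _ => ?_
  have : {N | N ∈ 𝒟 ∧ (N ∩ V).Nonempty} =
      Subtype.val '' {N : 𝒟 | ((N : Set X) ∩ V).Nonempty} := by
    ext N
    simp [and_comm]
  rw [this, Set.finite_image_iff Subtype.val_injective.injOn]

theorem LocallyFinite.coe_mono {X : Type*} [TopologicalSpace X] {𝒟 ℰ : Set (Set X)}
    (h : LocallyFinite (fun N : 𝒟 => (N : Set X))) (hs : ℰ ⊆ 𝒟) :
    LocallyFinite (fun N : ℰ => (N : Set X)) :=
  h.comp_injective (inclusion_injective hs)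

theorem LocallyFinite.coe_image_closure {X : Type*} [TopologicalSpace X] {𝒟 : Set (Set X)}
    (h : LocallyFinite (fun N : 𝒟 => (N : Set X))) :
    LocallyFinite (fun N : closure '' 𝒟 => (N : Set X)) := by
  rw [image_eq_range]
  exact h.closure.on_range

theorem LocallyFinite.coe_biUnion {X : Type*} [TopologicalSpace X] {𝒟 : ℕ → Set (Set X)}
    (h : ∀ n, LocallyFinite (fun N : 𝒟 n => (N : Set X))) (n : ℕ) :
    LocallyFinite (fun N : (⋃ k ≤ n, 𝒟 k : Set (Set X)) => (N : Set X)) := by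
  simp only [locallyFinite_coe_iff] at h ⊢
  intro x
  choose V hV hf using fun k => h k x
  refine ⟨⋂ k ∈ Iic n, V k, (biInter_mem (finite_Iic n)).2 fun k _ => hV k,
    ((finite_Iic n).biUnion fun k _ => hf k).subset ?_⟩
  rintro N ⟨hN, y, hyN, hy⟩
  simp only [mem_iUnion, mem_iInter, mem_Iic] at hN hy ⊢
  obtain ⟨k, hk, hN⟩ := hN
  exact ⟨k, hk, hN, y, hyN, hy k hk⟩

theorem LocallyFinite.coe_isClosed_sUnion {X : Type*} [TopologicalSpace X] {𝒟 : Set (Set X)}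
    (h : LocallyFinite (fun N : 𝒟 => (N : Set X))) (hc : ∀ N ∈ 𝒟, IsClosed N) :
    IsClosed (⋃₀ 𝒟) := by
  rw [sUnion_eq_iUnion]
  exact h.isClosed_iUnion fun N => hc N N.2

/-- The open neighborhood of `x` obtained by removing the members of a locally finite closed family
that do not contain `x`. -/
theorem isOpen_setOf_forall_mem_imp {X : Type*} [TopologicalSpace X] {ℳ : Set (Set X)}
    (h : LocallyFinite (fun N : ℳ => (N : Set X))) (hc : ∀ N ∈ ℳ, IsClosed N) (x : X) :
    IsOpen {y | ∀ N ∈ ℳ, y ∈ N → x ∈ N} := by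
  have h1 : IsClosed (⋃₀ {N | N ∈ ℳ ∧ x ∉ N}) :=
    (h.coe_mono fun N hN => hN.1).coe_isClosed_sUnion fun N hN => hc N hN.1
  convert h1.isOpen_compl using 1
  ext y
  simp only [mem_compl_iff, mem_sUnion, mem_ofPred_eq]
  grind

/-- A regular space is pseudometrizable if it has locally finite families `𝒟 n` such that, for each
open `O`, the interiors of the unions `⋃ {N ∈ 𝒟 0 ∪ ⋯ ∪ 𝒟 n | N ⊆ O}` cover `O`. -/
theorem pseudoMetrizableSpace_of_locallyFinite {X : Type*} [TopologicalSpace X] [RegularSpace X]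
    (𝒟 : ℕ → Set (Set X)) (hf : ∀ n, LocallyFinite (fun N : 𝒟 n => (N : Set X)))
    (h : ∀ x, ∀ O ∈ 𝓝 x, ∃ n, ⋃₀ {N | N ∈ ⋃ k ≤ n, 𝒟 k ∧ N ⊆ O} ∈ 𝓝 x) :
    TopologicalSpace.PseudoMetrizableSpace X := by
  let ℳ : ℕ → Set (Set X) := fun n => closure '' (⋃ k ≤ n, 𝒟 k)
  have hℳ : ∀ n, LocallyFinite (fun N : ℳ n => (N : Set X)) := fun n =>
    (LocallyFinite.coe_biUnion hf n).coe_image_closure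
  have hmono : ∀ m n, m ≤ n → ℳ m ⊆ ℳ n := fun m n hmn =>
    image_mono (biUnion_subset_biUnion_left fun k hk => le_trans hk hmn)
  have hc : ∀ n, ∀ N ∈ ℳ n, IsClosed N := by
    rintro n _ ⟨N, -, rfl⟩
    exact isClosed_closure
  have hint : ∀ x, ∀ O ∈ 𝓝 x, ∃ n, ∃ A ⊆ ℳ n, x ∈ interior (⋃₀ A) ∧ ⋃₀ A ⊆ O := by
    intro x O hO
    obtain ⟨C, hC, hCc, hCO⟩ := exists_mem_nhds_isClosed_subset hO
    obtain ⟨n, hn⟩ := h x C hC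
    refine ⟨n, closure '' {N | N ∈ ⋃ k ≤ n, 𝒟 k ∧ N ⊆ C}, image_mono fun N hN => hN.1, ?_, ?_⟩
    · rw [mem_interior_iff_mem_nhds]
      refine mem_of_superset hn ?_
      rintro y ⟨N, hN, hy⟩
      exact ⟨closure N, mem_image_of_mem _ hN, subset_closure hy⟩
    · rintro y ⟨_, ⟨N, hN, rfl⟩, hy⟩
      exact hCO (closure_minimal hN.2 hCc hy)
  -- The first clause gives a common point of two assigned sets a member `N` inside `O`; the second
  -- passes membership in `N` on to the other center.
  refine pseudoMetrizableSpace_of_transitive_nhds (fun n x => {y |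
      (∀ A ⊆ ℳ n, x ∈ interior (⋃₀ A) → y ∈ interior (⋃₀ A)) ∧ ∀ N ∈ ℳ n, y ∈ N → x ∈ N})
    (fun n x => ?_) (fun m n hmn x y hy => ?_) (fun n x y hy z hz => ?_) fun x O hO => ?_
  · set V : Set X := {y | ∀ N ∈ ℳ n, y ∈ N → x ∈ N} with hVdef
    have hV : IsOpen V := isOpen_setOf_forall_mem_imp (hℳ n) (hc n) x
    have hxV : x ∈ V := fun N _ hN => hN
    have hfin : {N | N ∈ ℳ n ∧ x ∈ N}.Finite := by
      obtain ⟨W, hW, hWf⟩ := locallyFinite_coe_iff.1 (hℳ n) x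
      exact hWf.subset fun N hN => ⟨hN.1, x, hN.2, mem_of_mem_nhds hW⟩
    have hall : ⋂ B ∈ {B | B ⊆ {N | N ∈ ℳ n ∧ x ∈ N} ∧ x ∈ interior (⋃₀ B)}, interior (⋃₀ B)
        ∈ 𝓝 x :=
      (biInter_mem (hfin.finite_subsets.subset fun B hB => hB.1)).2 fun B hB =>
        isOpen_interior.mem_nhds hB.2
    filter_upwards [hall, hV.mem_nhds hxV] with y hy hyV
    refine ⟨fun A hA hxA => ?_, hyV⟩
    -- Near `x` only the members containing `x` matter, so finitely many subfamilies suffice in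
    -- place of all `A ⊆ ℳ n`.
    have hsub : interior (⋃₀ A) ∩ V ⊆ ⋃₀ {N | N ∈ A ∧ x ∈ N} := by
      rintro z ⟨hz, hzV⟩
      obtain ⟨N, hN, hzN⟩ := interior_subset hz
      exact ⟨N, ⟨hN, hzV N (hA hN) hzN⟩, hzN⟩
    have hxB : x ∈ interior (⋃₀ {N | N ∈ A ∧ x ∈ N}) :=
      interior_maximal hsub (isOpen_interior.inter hV) ⟨hxA, hxV⟩
    have := mem_iInter₂.1 hy {N | N ∈ A ∧ x ∈ N} ⟨fun N hN => ⟨hA hN.1, hN.2⟩, hxB⟩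
    exact interior_mono (sUnion_subset_sUnion fun N hN => hN.1) this
  · exact ⟨fun A hA => hy.1 A (hA.trans (hmono m n hmn)), fun N hN => hy.2 N (hmono m n hmn hN)⟩
  · exact ⟨fun A hA hx => hz.1 A hA (hy.1 A hA hx), fun N hN hzN => hy.2 N hN (hz.2 N hN hzN)⟩
  · obtain ⟨n, A, hA, hxA, hAO⟩ := hint x O hO
    refine ⟨n, fun y ⟨z, hzx, hzy⟩ => ?_⟩
    obtain ⟨N, hN, hzN⟩ := interior_subset (hzx.1 A hA hxA)
    exact hAO ⟨N, hN, hzy.2 N (hA hN) hzN⟩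

/-! ### Sufficient conditions for metrizability -/

theorem IsPSpace.pseudoMetrizableSpace {X : Type*} [TopologicalSpace X] (hX : IsPSpace X)
    (ht : HasCountableFanTightness X) : TopologicalSpace.PseudoMetrizableSpace X := by
  obtain ⟨_, _, ⟨𝒟, rfl, hf⟩, hcp⟩ := hX
  refine pseudoMetrizableSpace_of_locallyFinite 𝒟 hf fun x O hO => ?_
  rcases hcp x with ⟨hx, hxN⟩ | ⟨hx, hN⟩
  · obtain ⟨n, hn⟩ := mem_iUnion.1 hxN
    refine ⟨n, mem_of_superset (hx.mem_nhds rfl) (subset_sUnion_of_mem ⟨?_, ?_⟩)⟩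
    · exact mem_biUnion (le_refl n) hn
    · exact singleton_subset_iff.2 (mem_of_mem_nhds hO)
  · by_contra! hcon
    have hacc : x ∈ closure ({x}ᶜ : Set X) \ {x}ᶜ := by
      refine ⟨?_, fun h => h rfl⟩
      rw [closure_compl, mem_compl_iff]
      intro h
      exact hx (by rwa [← singleton_subset_iff, subset_interior_iff_isOpen] at h)
    obtain ⟨N, hN0, hxN, hNO, -⟩ := hN _ hacc O hO
    obtain ⟨m, hm⟩ := mem_iUnion.1 hN0
    -- The shift by `m`, the level of some `N` with `x ∈ N ⊆ O`, keeps `x` out of every complement,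
    -- hence out of `⋃ n, B n`.
    obtain ⟨B, hB, hBx⟩ := ht x
      (fun n => (⋃₀ {N | N ∈ ⋃ k ≤ n + m, 𝒟 k ∧ N ⊆ O})ᶜ) fun n => by
        rw [closure_compl, mem_compl_iff, mem_interior_iff_mem_nhds]
        exact hcon _
    have hxB : x ∉ ⋃ n, B n := by
      rintro hx
      obtain ⟨n, hn⟩ := mem_iUnion.1 hx
      exact (hB n).2 hn ⟨N, ⟨mem_biUnion (Nat.le_add_left m n) hm, hNO⟩, hxN⟩
    obtain ⟨P, hP, hxP, hPO, hinf⟩ := hN _ ⟨hBx, hxB⟩ O hO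
    obtain ⟨l, hl⟩ := mem_iUnion.1 hP
    -- From index `l` on, `B n` avoids `P`, so `P` meets only the finitely many finite sets before
    -- it.
    refine hinf (((finite_Iio l).biUnion fun n _ => (hB n).1).subset ?_)
    rintro y ⟨hyP, hyB⟩
    obtain ⟨n, hn⟩ := mem_iUnion.1 hyB
    refine mem_biUnion (x := n) (mem_Iio.2 (not_le.1 fun hln => ?_)) hn
    exact (hB n).2 hn ⟨P, ⟨mem_biUnion (show l ≤ n + m by omega) hl, hPO⟩, hyP⟩

/-- A regular Fréchet–Urysohn space with property (α₄) is pseudometrizable if it has a σ-locally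
finite family that acts as a `k`-network for the compact subsets of small neighborhoods of
points. -/
theorem HasPropertyAlphaFour.pseudoMetrizableSpace {X : Type*} [TopologicalSpace X]
    [RegularSpace X] [FrechetUrysohnSpace X] (hα : HasPropertyAlphaFour X) {𝒩 : Set (Set X)}
    (hσ : IsSigmaLocallyFinite 𝒩)
    (h𝒩 : ∀ x, ∀ O ∈ 𝓝 x, ∃ U ∈ 𝓝 x, ∀ K, IsCompact K → K ⊆ U →
      ∃ ℱ ⊆ 𝒩, ℱ.Finite ∧ K ⊆ ⋃₀ ℱ ∧ ⋃₀ ℱ ⊆ O) :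
    TopologicalSpace.PseudoMetrizableSpace X := by
  obtain ⟨𝒟, rfl, hf⟩ := hσ
  refine pseudoMetrizableSpace_of_locallyFinite 𝒟 hf fun x O hO => ?_
  by_contra! hcon
  have hcl : ∀ n, x ∈ closure (⋃₀ {N | N ∈ ⋃ k ≤ n, 𝒟 k ∧ N ⊆ O})ᶜ := fun n => by
    rw [closure_compl, mem_compl_iff, mem_interior_iff_mem_nhds]
    exact hcon n
  choose u hu hux using fun n => mem_closure_iff_seq_limit.1 (hcl n)
  obtain ⟨m, n, hm, hlim⟩ := hα x u hux
  obtain ⟨U, hU, hUK⟩ := h𝒩 x O hO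
  obtain ⟨k₀, hk₀⟩ := eventually_atTop.1 (hlim.eventually hU)
  have hlim' := (tendsto_add_atTop_iff_nat k₀).2 hlim
  obtain ⟨ℱ, hℱ, hfin, hK, hFO⟩ := hUK _ hlim'.isCompact_insert_range (by
    rintro y (rfl | ⟨k, rfl⟩)
    · exact mem_of_mem_nhds hU
    · exact hk₀ _ (Nat.le_add_left _ _))
  have hlev : ∀ N ∈ ℱ, ∃ l, N ∈ 𝒟 l := fun N hN => mem_iUnion.1 (hℱ hN)
  choose! l hl using hlev
  obtain ⟨b, hb⟩ := (hfin.image l).bddAbove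
  -- Injectivity sends the row indices `m k` to infinity, past the level bound `b` of the finite
  -- cover.
  obtain ⟨k, hk⟩ := ((tendsto_add_atTop_iff_nat k₀).2 (Nat.cofinite_eq_atTop ▸
    hm.tendsto_cofinite)).eventually_ge_atTop b |>.exists
  obtain ⟨N, hN, hyN⟩ := hK (mem_insert_of_mem _ (mem_range_self k))
  exact hu _ _ ⟨N, ⟨mem_biUnion ((hb (mem_image_of_mem l hN)).trans hk) (hl N hN),
    (subset_sUnion_of_mem hN).trans hFO⟩, hyN⟩

theorem IsAlephSpace.pseudoMetrizableSpace {X : Type*} [TopologicalSpace X]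
    [FrechetUrysohnSpace X] (hX : IsAlephSpace X) (hα : HasPropertyAlphaFour X) :
    TopologicalSpace.PseudoMetrizableSpace X := by
  obtain ⟨_, 𝒩, hσ, hk⟩ := hX
  refine hα.pseudoMetrizableSpace hσ fun x O hO => ⟨interior O, interior_mem_nhds.2 hO, ?_⟩
  intro K hK hKO
  obtain ⟨ℱ, h1, h2, h3, h4⟩ := hk K _ hK isOpen_interior hKO
  exact ⟨ℱ, h1, h2, h3, h4.trans interior_subset⟩

theorem IsStrictAlephSpace.pseudoMetrizableSpace {X : Type*} [TopologicalSpace X]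
    [FrechetUrysohnSpace X] (hX : IsStrictAlephSpace X) (hα : HasPropertyAlphaFour X) :
    TopologicalSpace.PseudoMetrizableSpace X := by
  obtain ⟨_, 𝒩, hσ, hk⟩ := hX
  refine hα.pseudoMetrizableSpace hσ fun x O hO => ?_
  obtain ⟨U, hU, hUK⟩ := hk x O hO
  refine ⟨U, hU, fun K hK hKU => ?_⟩
  obtain ⟨ℱ, h1, h2, -, h3, h4⟩ := hUK K hK hKU
  exact ⟨ℱ, h1, h2, h3, h4⟩

/-! ### σ-locally finite networks in M-spaces -/

/-- A space is paracompact if it maps continuously to a pseudometrizable space in such a way that,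
for every open cover, each point of the target has a neighborhood whose preimage is covered by
finitely many members. -/
theorem ParacompactSpace.of_continuous {X Y : Type*} [TopologicalSpace X] [TopologicalSpace Y]
    [TopologicalSpace.PseudoMetrizableSpace Y] {f : X → Y} (hf : Continuous f)
    (h : ∀ 𝒢 : Set (Set X), (∀ G ∈ 𝒢, IsOpen G) → ⋃₀ 𝒢 = univ →
      ∀ y, ∃ U ∈ 𝓝 y, ∃ ℱ ⊆ 𝒢, ℱ.Finite ∧ f ⁻¹' U ⊆ ⋃₀ ℱ) : ParacompactSpace X := by
  let _ := TopologicalSpace.pseudoMetrizableSpacePseudoMetric Y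
  refine ⟨fun α s ho hu => ?_⟩
  choose U hU ℱ hℱ hfin hsub using h (range s) (forall_mem_range.2 ho) (by rwa [sUnion_range])
  obtain ⟨v, hvo, hvc, hvf, hvU⟩ := precise_refinement (fun y => interior (U y))
    (fun y => isOpen_interior)
    (eq_univ_of_forall fun y => mem_iUnion.2 ⟨y, mem_interior_iff_mem_nhds.2 (hU y)⟩)
  have hpre : LocallyFinite fun y => f ⁻¹' v y := hvf.preimage_continuous hf
  -- Each `G` is cut down to the pieces whose finite subcover uses it; a point sees finitely many
  -- pieces, each using finitely many `G`.
  refine ⟨range s, fun G => G ∩ ⋃ y ∈ {y | (G : Set X) ∈ ℱ y}, f ⁻¹' v y, ?_, ?_, ?_, ?_⟩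
  · rintro ⟨_, i, rfl⟩
    exact (ho i).inter (isOpen_biUnion fun y _ => (hvo y).preimage hf)
  · refine eq_univ_of_forall fun x => ?_
    obtain ⟨y, hy⟩ := mem_iUnion.1 (hvc.symm ▸ mem_univ (f x))
    obtain ⟨G, hG, hxG⟩ := hsub y (mem_preimage.2 (interior_subset (hvU y hy)))
    exact mem_iUnion.2 ⟨⟨G, hℱ y hG⟩, hxG, mem_biUnion (x := y) hG hy⟩
  · intro x
    obtain ⟨W, hW, hWf⟩ := hpre x
    refine ⟨W, hW, Finite.of_finite_image
      ((hWf.biUnion fun y _ => hfin y).subset ?_) Subtype.val_injective.injOn⟩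
    rintro _ ⟨G, ⟨z, ⟨-, hz⟩, hzW⟩, rfl⟩
    obtain ⟨y, hy, hzy⟩ := mem_iUnion₂.1 hz
    exact mem_biUnion (x := y) ⟨z, hzy, hzW⟩ hy
  · rintro ⟨_, i, rfl⟩
    exact ⟨i, inter_subset_left⟩

/-- Otherwise distinct members `N n` and points `u n ∈ N n ∩ S n` can be chosen recursively, and
every neighborhood of a cluster point of `u` meets infinitely many members. -/
theorem locallyFinite_mem_finite_of_cluster {X : Type*} [TopologicalSpace X] {𝒟 : Set (Set X)}
    (hf : LocallyFinite (fun N : 𝒟 => (N : Set X))) (S : ℕ → Set X)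
    (hS : ∀ u : ℕ → X, (∀ n, u n ∈ S n) → ∃ y, MapClusterPt y atTop u) :
    ∃ n, {N | N ∈ 𝒟 ∧ (N ∩ S n).Nonempty}.Finite := by
  by_contra! hinf
  have hstep : ∀ (n : ℕ) (F : Set (Set X)), F.Finite → ∃ N ∈ 𝒟, (N ∩ S n).Nonempty ∧ N ∉ F :=
    fun n F hF => by
      obtain ⟨N, hN, hNF⟩ := (hinf n).exists_notMem_finite hF
      exact ⟨N, hN.1, hN.2, hNF⟩
  choose! N hN𝒟 hNS hNF using fun (n : ℕ) (F : Finset (Set X)) => hstep n F F.finite_toSet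
  let s : ℕ → Finset (Set X) := fun n => by
    classical exact Nat.rec ∅ (fun n F => insert (N n F) F) n
  have hs : ∀ n, N n (s n) ∈ s (n + 1) := fun n => Finset.mem_insert_self _ _
  have hsm : Monotone s := monotone_nat_of_le_succ fun n => Finset.subset_insert _ _
  choose u hu using fun n => hNS n (s n)
  obtain ⟨y, hy⟩ := hS u fun n => (hu n).2
  obtain ⟨V, hV, hVf⟩ := locallyFinite_coe_iff.1 hf y
  have hinj : Function.Injective fun n => N n (s n) := by
    refine .of_lt_imp_ne fun m n hmn heq => hNF n (s n) ?_
    rw [← heq]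
    exact hsm hmn (hs m)
  have hfreq := (mapClusterPt_iff_frequently.1 hy V hV)
  rw [Nat.frequently_atTop_iff_infinite] at hfreq
  refine (hfreq.image hinj.injOn) (hVf.subset ?_)
  rintro _ ⟨n, hn, rfl⟩
  exact ⟨hN𝒟 _ _, u n, (hu n).1, hn⟩

/-- If `E n` are relations as in the definition of an M-space, then a cluster point of a sequence
`u` with `E n x (u n)` for all `n` is `E n`-related to `x` for all `n`. -/
theorem MapClusterPt.forall_rel {X : Type*} [TopologicalSpace X] {E : ℕ → X → X → Prop}
    (refl : ∀ n x, E n x x) (symm : ∀ n x y, E n x y → E n y x)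
    (comp : ∀ n x y z, E (n + 1) x y → E (n + 1) y z → E n x z)
    (mem : ∀ n x, {y | E n x y} ∈ 𝓝 x) {x y : X} {u : ℕ → X} (hu : ∀ n, E n x (u n))
    (hy : MapClusterPt y atTop u) (n : ℕ) : E n x y := by
  have anti : ∀ m n, m ≤ n → ∀ x y, E n x y → E m x y := by
    intro m n h
    induction h with
    | refl => exact fun _ _ h => h
    | step _ ih => exact fun x y h => ih x y (comp _ x x y (refl _ x) h)
  obtain ⟨k, hk, hnk⟩ := ((mapClusterPt_iff_frequently.1 hy _ (mem (n + 1) y)).and_eventually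
    (eventually_ge_atTop (n + 1))).exists
  exact comp n x (u k) y (anti _ _ hnk _ _ (hu k)) (symm _ _ _ hk)

/-- Only finitely many members of `𝒟 k` meet the `E (l k)`-ball of `x`; those lying in some `G ∈ 𝒢`
select a finite `H k`. If no `H 0 ∪ ⋯ ∪ H n` covered the `E n`-ball, a cluster point of uncovered
points would lie in every ball, hence in a set already selected. So the identity to the topology of
`E` meets the finite-cover criterion. -/
theorem ParacompactSpace.of_locallyFinite_network {X : Type*} [tX : TopologicalSpace X]
    {E : ℕ → X → X → Prop}
    (refl : ∀ n x, E n x x) (symm : ∀ n x y, E n x y → E n y x)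
    (comp : ∀ n x y z, E (n + 1) x y → E (n + 1) y z → E n x z)
    (mem : ∀ n x, {y | E n x y} ∈ 𝓝 x)
    (clus : ∀ x (u : ℕ → X), (∀ n, E n x (u n)) → ∃ y, MapClusterPt y atTop u)
    (𝒟 : ℕ → Set (Set X)) (hf : ∀ n, LocallyFinite (fun N : 𝒟 n => (N : Set X)))
    (net : ∀ x, ∀ O ∈ 𝓝 x, ∃ n, ∃ N ∈ 𝒟 n, x ∈ N ∧ N ⊆ O) : ParacompactSpace X := by
  have cover : ∀ 𝒢 : Set (Set X), (∀ G ∈ 𝒢, IsOpen G) → ⋃₀ 𝒢 = univ →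
      ∀ x, ∃ n, ∃ ℱ ⊆ 𝒢, ℱ.Finite ∧ {y | E n x y} ⊆ ⋃₀ ℱ := by
    intro 𝒢 hG hcov x
    choose l hl using fun k =>
      locallyFinite_mem_finite_of_cluster (hf k) (fun n => {y | E n x y}) (clus x)
    have hγ : ∀ N : Set X, (∃ G ∈ 𝒢, N ⊆ G) → ∃ G ∈ 𝒢, N ⊆ G := fun N h => h
    choose! γ hγ𝒢 hγN using hγ
    let H : ℕ → Set (Set X) := fun k =>
      γ '' {N | (N ∈ 𝒟 k ∧ (N ∩ {y | E (l k) x y}).Nonempty) ∧ ∃ G ∈ 𝒢, N ⊆ G}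
    have hH : ∀ k, (H k).Finite := fun k => ((hl k).subset fun N hN => hN.1).image γ
    have hH𝒢 : ∀ k, H k ⊆ 𝒢 := by
      rintro k _ ⟨N, hN, rfl⟩
      exact hγ𝒢 N hN.2
    suffices h : ∃ n, {y | E n x y} ⊆ ⋃₀ ⋃ k ∈ Iic n, H k by
      obtain ⟨n, hn⟩ := h
      exact ⟨n, _, iUnion₂_subset fun k _ => hH𝒢 k,
        (finite_Iic n).biUnion fun k _ => hH k, hn⟩
    by_contra! hcon
    choose u hu huH using fun n => not_subset.1 (hcon n)
    obtain ⟨y, hy⟩ := clus x u hu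
    obtain ⟨G, hG𝒢, hyG⟩ := hcov.symm ▸ mem_univ y
    obtain ⟨k, N, hN, hyN, hNG⟩ := net y G ((hG G hG𝒢).mem_nhds hyG)
    have hNex : ∃ G ∈ 𝒢, N ⊆ G := ⟨G, hG𝒢, hNG⟩
    obtain ⟨n, hn, hkn⟩ := ((mapClusterPt_iff_frequently.1 hy (γ N)
      ((hG _ (hγ𝒢 N hNex)).mem_nhds (hγN N hNex hyN))).and_eventually
      (eventually_ge_atTop k)).exists
    refine huH n ⟨γ N, mem_biUnion (x := k) hkn ⟨N, ⟨⟨hN, y, hyN, ?_⟩, hNex⟩, rfl⟩, hn⟩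
    exact MapClusterPt.forall_rel refl symm comp mem hu hy _
  obtain ⟨t, ht, hb⟩ := exists_pseudoMetrizable_hasBasis E refl symm comp
  refine @ParacompactSpace.of_continuous X X tX t ht id ?_ fun 𝒢 hG hcov x => ?_
  · exact continuous_id_iff_le.2 ((le_iff_nhds _ _).2 fun x => (hb x).ge_iff.2 fun n _ => mem n x)
  · obtain ⟨n, h⟩ := cover 𝒢 hG hcov x
    exact ⟨_, (hb x).mem_of_mem trivial, h⟩

theorem LocallyFinite.coe_image2_inter {X : Type*} [TopologicalSpace X] {𝒜 ℬ : Set (Set X)}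
    (hA : LocallyFinite (fun N : 𝒜 => (N : Set X)))
    (hB : LocallyFinite (fun N : ℬ => (N : Set X))) :
    LocallyFinite (fun N : image2 (· ∩ ·) 𝒜 ℬ => (N : Set X)) := by
  rw [locallyFinite_coe_iff] at *
  intro x
  obtain ⟨V, hV, hVf⟩ := hA x
  obtain ⟨W, hW, hWf⟩ := hB x
  refine ⟨V ∩ W, inter_mem hV hW, (hVf.image2 (· ∩ ·) hWf).subset ?_⟩
  rintro _ ⟨⟨A, hA, B, hB, rfl⟩, y, ⟨hyA, hyB⟩, hyV, hyW⟩
  exact ⟨A, ⟨hA, y, hyA, hyV⟩, B, ⟨hB, y, hyB, hyW⟩, rfl⟩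

/-- A regular space with a `σ`-locally finite closed network is pseudometrizable if it is
paracompact and has relations as in the definition of an M-space. -/
theorem pseudoMetrizableSpace_of_closed_network {X : Type*} [TopologicalSpace X] [T2Space X]
    [RegularSpace X] [ParacompactSpace X] {E : ℕ → X → X → Prop}
    (symm : ∀ n x y, E n x y → E n y x)
    (comp : ∀ n x y z, E (n + 1) x y → E (n + 1) y z → E n x z)
    (mem : ∀ n x, {y | E n x y} ∈ 𝓝 x)
    (clus : ∀ x (u : ℕ → X), (∀ n, E n x (u n)) → ∃ y, MapClusterPt y atTop u)
    (ℳ : ℕ → Set (Set X)) (hf : ∀ n, LocallyFinite (fun N : ℳ n => (N : Set X)))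
    (hc : ∀ n, ∀ N ∈ ℳ n, IsClosed N) (hmono : Monotone ℳ)
    (net : ∀ x, ∀ O ∈ 𝓝 x, ∃ n, ∃ N ∈ ℳ n, x ∈ N ∧ N ⊆ O) :
    TopologicalSpace.PseudoMetrizableSpace X := by
  let V : ℕ → X → Set X := fun n z => {y | ∀ N ∈ ℳ n, y ∈ N → z ∈ N}
  have hV : ∀ n z, V n z ∈ 𝓝 z := fun n z =>
    (isOpen_setOf_forall_mem_imp (hf n) (hc n) z).mem_nhds fun N _ h => h
  have hlim : ∀ (z : ℕ → X) x, (∀ n, x ∈ V n (z n)) → Tendsto z atTop (𝓝 x) := by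
    intro z x hz O hO
    obtain ⟨m, N, hN, hxN, hNO⟩ := net x O hO
    refine mem_map.2 ((eventually_ge_atTop m).mono fun n hn => ?_)
    exact hNO (hz n N (hmono hn hN) hxN)
  let Q : ℕ → X → X → Prop := fun n x y => E n x y ∧ ∃ z, x ∈ V n z ∧ y ∈ V n z
  have hQ : ∀ x y, (∀ n, Q n x y) → x = y := by
    intro x y h
    choose z hx hy using fun n => (h n).2
    exact tendsto_nhds_unique (hlim z x hx) (hlim z y hy)
  choose C hC hCc hCs using fun n x =>
    exists_mem_nhds_isClosed_subset (inter_mem (hV n x) (mem (n + 1) x))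
  have hCQ : ∀ n z, ∀ x ∈ C n z, ∀ y ∈ C n z, Q n x y := fun n z x hx y hy =>
    ⟨comp n x z y (symm _ _ _ (hCs n z hx).2) (hCs n z hy).2, z, (hCs n z hx).1, (hCs n z hy).1⟩
  choose v hvo hvc hvf hvC using fun n => precise_refinement (fun x => interior (C n x))
    (fun x => isOpen_interior)
    (eq_univ_of_forall fun x => mem_iUnion.2 ⟨x, mem_interior_iff_mem_nhds.2 (hC n x)⟩)
  let ℬ : ℕ → Set (Set X) := fun n => range fun x => closure (v n x)
  have hℬf : ∀ n, LocallyFinite (fun N : ℬ n => (N : Set X)) := fun n => (hvf n).closure.on_range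
  have hℬc : ∀ n, ∀ N ∈ ℬ n, IsClosed N := by
    rintro n _ ⟨x, rfl⟩
    exact isClosed_closure
  have hℬQ : ∀ n, ∀ N ∈ ℬ n, ∀ x ∈ N, ∀ y ∈ N, Q n x y := by
    rintro n _ ⟨z, rfl⟩ x hx y hy
    have := closure_minimal ((hvC n z).trans interior_subset) (hCc n z)
    exact hCQ n z x (this hx) y (this hy)
  have hℬu : ∀ n x, ∃ N ∈ ℬ n, x ∈ N := fun n x => by
    obtain ⟨z, hz⟩ := mem_iUnion.1 ((hvc n).symm ▸ mem_univ x)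
    exact ⟨_, mem_range_self z, subset_closure hz⟩
  obtain ⟨𝒞, h𝒞0, h𝒞s⟩ : ∃ 𝒞 : ℕ → Set (Set X), 𝒞 0 = ℬ 0 ∧
      ∀ n, 𝒞 (n + 1) = image2 (· ∩ ·) (𝒞 n) (ℬ (n + 1)) :=
    ⟨fun n => Nat.rec (ℬ 0) (fun k 𝒜 => image2 (· ∩ ·) 𝒜 (ℬ (k + 1))) n, rfl, fun _ => rfl⟩
  have h𝒞f : ∀ n, LocallyFinite (fun N : 𝒞 n => (N : Set X)) := by
    intro n
    induction n with
    | zero => rw [h𝒞0]; exact hℬf 0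
    | succ n ih => rw [h𝒞s]; exact ih.coe_image2_inter (hℬf _)
  have h𝒞c : ∀ n, ∀ N ∈ 𝒞 n, IsClosed N := by
    intro n
    induction n with
    | zero => rw [h𝒞0]; exact hℬc 0
    | succ n ih =>
      rw [h𝒞s]
      rintro _ ⟨A, hA, B, hB, rfl⟩
      exact (ih A hA).inter (hℬc _ B hB)
  have h𝒞u : ∀ n x, ∃ N ∈ 𝒞 n, x ∈ N := by
    intro n x
    induction n with
    | zero => rw [h𝒞0]; exact hℬu 0 x
    | succ n ih =>
      obtain ⟨A, hA, hxA⟩ := ih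
      obtain ⟨B, hB, hxB⟩ := hℬu (n + 1) x
      rw [h𝒞s]
      exact ⟨A ∩ B, mem_image2_of_mem hA hB, hxA, hxB⟩
  have h𝒞Q : ∀ n, ∀ N ∈ 𝒞 n, ∀ x ∈ N, ∀ y ∈ N, Q n x y := by
    intro n
    cases n with
    | zero => rw [h𝒞0]; exact hℬQ 0
    | succ n =>
      rw [h𝒞s]
      rintro _ ⟨A, hA, B, hB, rfl⟩ x hx y hy
      exact hℬQ _ B hB x hx.2 y hy.2
  have h𝒞r : ∀ m n, m ≤ n → ∀ N ∈ 𝒞 n, ∃ P ∈ 𝒞 m, N ⊆ P := by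
    intro m n h
    induction h with
    | refl => exact fun N hN => ⟨N, hN, Subset.rfl⟩
    | step _ ih =>
      rw [h𝒞s]
      rintro _ ⟨A, hA, B, hB, rfl⟩
      obtain ⟨P, hP, hAP⟩ := ih A hA
      exact ⟨P, hP, inter_subset_left.trans hAP⟩
  refine pseudoMetrizableSpace_of_locallyFinite 𝒞 h𝒞f fun x O hO => ?_
  by_contra! hcon
  -- Otherwise the star of `x` in `𝒞 n` lies in `O`; it is a neighborhood of `x`, because points
  -- near `x` lie only in members containing `x`.
  have hex : ∀ n, ∃ y, y ∉ interior O ∧ ∃ N ∈ 𝒞 n, x ∈ N ∧ y ∈ N := by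
    intro n
    by_contra! hno
    refine hcon n (mem_of_superset ((isOpen_setOf_forall_mem_imp (h𝒞f n) (h𝒞c n) x).mem_nhds
      fun N _ h => h) fun y hy => ?_)
    obtain ⟨N, hN, hyN⟩ := h𝒞u n y
    refine ⟨N, ⟨mem_biUnion (le_refl n) hN, fun w hw => ?_⟩, hyN⟩
    by_contra hwO
    exact hno w (fun h => hwO (interior_subset h)) N hN (hy N hN hyN) hw
  choose u huO N hN hxN huN using hex
  obtain ⟨y, hy⟩ := clus x u fun n => (h𝒞Q n (N n) (hN n) x (hxN n) (u n) (huN n)).1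
  have hyO : y ∉ interior O := fun h => by
    obtain ⟨n, hn⟩ := (mapClusterPt_iff_frequently.1 hy _ (isOpen_interior.mem_nhds h)).exists
    exact huO n hn
  -- As `𝒞 n` refines `𝒞 m` for `n ≥ m`, the sequence is eventually in the closed star of `x` in `𝒞
  -- m`, and so is its cluster point.
  have hxy : x = y := hQ x y fun m => by
    have hcl : IsClosed (⋃₀ {P | P ∈ 𝒞 m ∧ x ∈ P}) :=
      ((h𝒞f m).coe_mono fun P hP => hP.1).coe_isClosed_sUnion fun P hP => h𝒞c m P hP.1
    have hev : ∀ᶠ n in atTop, u n ∈ ⋃₀ {P | P ∈ 𝒞 m ∧ x ∈ P} := by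
      filter_upwards [eventually_ge_atTop m] with n hn
      obtain ⟨P, hP, hNP⟩ := h𝒞r m n hn (N n) (hN n)
      exact ⟨P, ⟨hP, hNP (hxN n)⟩, hNP (huN n)⟩
    obtain ⟨P, hP, hyP⟩ : y ∈ ⋃₀ {P | P ∈ 𝒞 m ∧ x ∈ P} := by
      by_contra hyn
      obtain ⟨n, h1, h2⟩ := ((mapClusterPt_iff_frequently.1 hy _
        (hcl.isOpen_compl.mem_nhds hyn)).and_eventually hev).exists
      exact h1 h2
    exact h𝒞Q m P hP.1 x hP.2 y hyP
  exact hyO (hxy ▸ mem_interior_iff_mem_nhds.2 hO)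

theorem IsStrictSigmaSpace.pseudoMetrizableSpace {X : Type*} [TopologicalSpace X] [T2Space X]
    (hX : IsStrictSigmaSpace X) (hM : IsMSpace X) : TopologicalSpace.PseudoMetrizableSpace X := by
  obtain ⟨_, _, ⟨𝒟, rfl, hf⟩, hcn⟩ := hX
  obtain ⟨𝒰, hcov, hclus, hstar⟩ := hM
  have hnet : ∀ x, ∀ O ∈ 𝓝 x, ∃ n, ∃ N ∈ 𝒟 n, x ∈ N ∧ N ⊆ O := by
    intro x O hO
    obtain ⟨N, ⟨hN, hxN, hNO⟩, -⟩ := mem_of_mem_nhds (hcn x O hO)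
    obtain ⟨n, hn⟩ := mem_iUnion.1 hN
    exact ⟨n, N, hn, hxN, hNO⟩
  let E : ℕ → X → X → Prop := fun n x y => ∃ U ∈ 𝒰 n, x ∈ U ∧ y ∈ U
  have hex : ∀ n x, ∃ U ∈ 𝒰 n, x ∈ U := fun n x => mem_sUnion.1 ((hcov n).2.symm ▸ mem_univ x)
  have refl : ∀ n x, E n x x := fun n x => by
    obtain ⟨U, hU, hx⟩ := hex n x
    exact ⟨U, hU, hx, hx⟩
  have symm : ∀ n x y, E n x y → E n y x := fun n x y ⟨U, hU, hx, hy⟩ => ⟨U, hU, hy, hx⟩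
  have comp : ∀ n x y z, E (n + 1) x y → E (n + 1) y z → E n x z := by
    rintro n x y z ⟨U, hU, hx, hy⟩ ⟨V, hV, hy', hz⟩
    obtain ⟨W, hW, hUW⟩ := hstar n U hU
    exact ⟨W, hW, hUW ⟨U, ⟨hU, y, hy, hy⟩, hx⟩, hUW ⟨V, ⟨hV, y, hy', hy⟩, hz⟩⟩
  have mem : ∀ n x, {y | E n x y} ∈ 𝓝 x := fun n x => by
    obtain ⟨U, hU, hx⟩ := hex n x
    exact mem_of_superset (((hcov n).1 U hU).mem_nhds hx) fun y hy => ⟨U, hU, hx, hy⟩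
  have clus : ∀ x (u : ℕ → X), (∀ n, E n x (u n)) → ∃ y, MapClusterPt y atTop u := by
    refine fun x u hu => hclus x u fun n => ?_
    obtain ⟨U, hU, hx, hy⟩ := hu n
    exact ⟨U, ⟨hU, hx⟩, hy⟩
  have := ParacompactSpace.of_locallyFinite_network refl symm comp mem clus 𝒟 hf hnet
  refine pseudoMetrizableSpace_of_closed_network symm comp mem clus
    (fun n => closure '' (⋃ k ≤ n, 𝒟 k))
    (fun n => (LocallyFinite.coe_biUnion hf n).coe_image_closure) ?_ ?_ fun x O hO => ?_
  · rintro n _ ⟨N, -, rfl⟩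
    exact isClosed_closure
  · exact fun m n hmn => image_mono (biUnion_subset_biUnion_left fun k hk => le_trans hk hmn)
  · obtain ⟨C, hC, hCc, hCO⟩ := exists_mem_nhds_isClosed_subset hO
    obtain ⟨n, N, hN, hxN, hNC⟩ := hnet x C hC
    exact ⟨n, closure N, mem_image_of_mem _ (mem_biUnion (le_refl n) hN), subset_closure hxN,
      (closure_minimal hNC hCc).trans hCO⟩

/-! ### Metrizable spaces -/

theorem exists_sigmaLocallyFinite_basis (X : Type*) [TopologicalSpace X]
    [TopologicalSpace.PseudoMetrizableSpace X] :
    ∃ 𝒩 : Set (Set X), IsSigmaLocallyFinite 𝒩 ∧ (∀ N ∈ 𝒩, IsOpen N) ∧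
      ∀ x, ∀ O ∈ 𝓝 x, ∃ N ∈ 𝒩, x ∈ N ∧ N ⊆ O := by
  let _ := TopologicalSpace.pseudoMetrizableSpacePseudoMetric X
  choose v hvo hvc hvf hvs using fun n : ℕ => precise_refinement
    (fun x : X => Metric.ball x (1 / (n + 1 : ℝ))) (fun x => Metric.isOpen_ball)
    (eq_univ_of_forall fun x => mem_iUnion.2 ⟨x, Metric.mem_ball_self Nat.one_div_pos_of_nat⟩)
  refine ⟨⋃ n, range (v n), ⟨fun n => range (v n), rfl, fun n => (hvf n).on_range⟩, ?_, ?_⟩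
  · rintro N hN
    obtain ⟨n, z, rfl⟩ := mem_iUnion.1 hN
    exact hvo n z
  · intro x O hO
    obtain ⟨ε, hε, hO⟩ := Metric.mem_nhds_iff.1 hO
    -- Two points of `v n z` are both within `ε / 2` of `z`.
    obtain ⟨n, hn⟩ := exists_nat_one_div_lt (half_pos hε)
    obtain ⟨z, hz⟩ := mem_iUnion.1 ((hvc n).symm ▸ mem_univ x)
    refine ⟨v n z, mem_iUnion.2 ⟨n, z, rfl⟩, hz, fun y hy => hO ?_⟩
    have h1 := Metric.mem_ball.1 (hvs n z hz)
    have h2 := Metric.mem_ball.1 (hvs n z hy)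
    have h3 := dist_triangle_right y x z
    rw [Metric.mem_ball]
    linarith

theorem isKNetwork_of_basis {X : Type*} [TopologicalSpace X] {𝒩 : Set (Set X)}
    (ho : ∀ N ∈ 𝒩, IsOpen N) (hb : ∀ x, ∀ O ∈ 𝓝 x, ∃ N ∈ 𝒩, x ∈ N ∧ N ⊆ O) :
    IsKNetwork 𝒩 := by
  intro K U hK hU hKU
  obtain ⟨t, ht, htf, hKt⟩ := hK.elim_finite_subcover_image (b := {N | N ∈ 𝒩 ∧ N ⊆ U}) (c := id)
    (fun N hN => ho N hN.1) fun x hx => by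
      obtain ⟨N, hN, hxN, hNU⟩ := hb x U (hU.mem_nhds (hKU hx))
      exact mem_biUnion (x := N) ⟨hN, hNU⟩ hxN
  exact ⟨t, fun N hN => (ht hN).1, htf, by rwa [sUnion_eq_biUnion],
    sUnion_subset fun N hN => (ht hN).2⟩

theorem isCkNetwork_of_basis {X : Type*} [TopologicalSpace X] {𝒩 : Set (Set X)}
    (ho : ∀ N ∈ 𝒩, IsOpen N) (hb : ∀ x, ∀ O ∈ 𝓝 x, ∃ N ∈ 𝒩, x ∈ N ∧ N ⊆ O) :
    IsCkNetwork 𝒩 := by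
  intro x O hO
  obtain ⟨N, hN, hxN, hNO⟩ := hb x O hO
  exact ⟨N, (ho N hN).mem_nhds hxN, fun K _ hKN =>
    ⟨{N}, by simpa using hN, finite_singleton N, by simpa using hxN, by simpa using hKN,
      by simpa using hNO⟩⟩

theorem isCnNetwork_of_basis {X : Type*} [TopologicalSpace X] {𝒩 : Set (Set X)}
    (ho : ∀ N ∈ 𝒩, IsOpen N) (hb : ∀ x, ∀ O ∈ 𝓝 x, ∃ N ∈ 𝒩, x ∈ N ∧ N ⊆ O) :
    IsCnNetwork 𝒩 := by
  intro x O hO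
  obtain ⟨N, hN, hxN, hNO⟩ := hb x O hO
  exact mem_of_superset ((ho N hN).mem_nhds hxN) (subset_sUnion_of_mem ⟨hN, hxN, hNO⟩)

theorem isCpNetwork_of_basis {X : Type*} [TopologicalSpace X] [T1Space X] {𝒩 : Set (Set X)}
    (ho : ∀ N ∈ 𝒩, IsOpen N) (hb : ∀ x, ∀ O ∈ 𝓝 x, ∃ N ∈ 𝒩, x ∈ N ∧ N ⊆ O) :
    IsCpNetwork 𝒩 := by
  intro x
  by_cases hx : IsOpen ({x} : Set X)
  · obtain ⟨N, hN, hxN, hNx⟩ := hb x {x} (hx.mem_nhds rfl)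
    have : N = {x} := hNx.antisymm (singleton_subset_iff.2 hxN)
    exact Or.inl ⟨hx, this ▸ hN⟩
  · refine Or.inr ⟨hx, fun A hA O hO => ?_⟩
    obtain ⟨N, hN, hxN, hNO⟩ := hb x O hO
    refine ⟨N, hN, hxN, hNO, fun hfin => ?_⟩
    -- Removing the finite set `N ∩ A`, which omits `x`, leaves an open neighborhood of `x` that
    -- misses `A`.
    obtain ⟨y, ⟨hyN, hy⟩, hyA⟩ := mem_closure_iff.1 hA.1 (N ∩ (N ∩ A)ᶜ)
      ((ho N hN).inter hfin.isClosed.isOpen_compl) ⟨hxN, fun h => hA.2 h.2⟩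
    exact hy ⟨hyN, hyA⟩

theorem hasCountableFanTightness_of_firstCountable (X : Type*) [TopologicalSpace X]
    [FirstCountableTopology X] : HasCountableFanTightness X := by
  intro x A hA
  obtain ⟨V, hV⟩ := (𝓝 x).exists_antitone_basis
  choose y hyV hyA using fun n => mem_closure_iff_nhds.1 (hA n) (V n) (hV.mem n)
  refine ⟨fun n => {y n}, fun n => ⟨finite_singleton _, singleton_subset_iff.2 (hyA n)⟩, ?_⟩
  refine mem_closure_of_tendsto (hV.tendsto hyV) (Eventually.of_forall fun n => ?_)
  exact mem_iUnion.2 ⟨n, rfl⟩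

theorem hasPropertyAlphaFour_of_firstCountable (X : Type*) [TopologicalSpace X]
    [FirstCountableTopology X] : HasPropertyAlphaFour X := by
  intro x u hu
  obtain ⟨V, hV⟩ := (𝓝 x).exists_antitone_basis
  choose n hn using fun m => ((hu m).eventually (hV.mem m)).exists
  exact ⟨id, n, Function.injective_id, hV.tendsto hn⟩

theorem isMSpace_of_pseudoMetrizable (X : Type*) [TopologicalSpace X]
    [TopologicalSpace.PseudoMetrizableSpace X] : IsMSpace X := by
  let _ := TopologicalSpace.pseudoMetrizableSpacePseudoMetric X
  have hpos : ∀ n : ℕ, (0 : ℝ) < (1 / 3) ^ n := fun n => by positivity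
  -- Ratio 1/3: a point of a ball meeting the ball about `z` is within three radii of `z`, the
  -- radius one level up.
  refine ⟨fun n => range fun x : X => Metric.ball x ((1 / 3) ^ n), fun n => ⟨?_, ?_⟩, ?_, ?_⟩
  · rintro _ ⟨x, rfl⟩
    exact Metric.isOpen_ball
  · exact eq_univ_of_forall fun x => ⟨_, mem_range_self x, Metric.mem_ball_self (hpos n)⟩
  · intro x u hu
    refine ⟨x, Tendsto.mapClusterPt ?_⟩
    rw [tendsto_iff_dist_tendsto_zero]
    have hlim : Tendsto (fun n : ℕ => 2 * (1 / 3 : ℝ) ^ n) atTop (𝓝 0) := by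
      simpa using (tendsto_pow_atTop_nhds_zero_of_lt_one (r := (1 / 3 : ℝ))
        (by norm_num) (by norm_num)).const_mul 2
    refine squeeze_zero (fun n => dist_nonneg) (fun n => ?_) hlim
    obtain ⟨_, ⟨⟨z, rfl⟩, hx⟩, huz⟩ := hu n
    rw [Metric.mem_ball] at hx huz
    linarith [dist_triangle_right (u n) x z]
  · rintro n _ ⟨z, rfl⟩
    refine ⟨_, mem_range_self z, ?_⟩
    rintro y ⟨_, ⟨⟨w, rfl⟩, p, hpw, hpz⟩, hyw⟩
    rw [Metric.mem_ball] at *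
    have h1 := dist_triangle y w z
    have h2 := dist_triangle_left w z p
    rw [pow_succ] at *
    linarith

theorem theorem4p4 (X : Type*) [TopologicalSpace X] [T2Space X] :
    List.TFAE [
      TopologicalSpace.MetrizableSpace X,
      IsPSpace X ∧ HasCountableFanTightness X,
      IsAlephSpace X ∧ FrechetUrysohnSpace X ∧ HasPropertyAlphaFour X,
      IsStrictAlephSpace X ∧ FrechetUrysohnSpace X ∧ HasPropertyAlphaFour X,
      IsStrictSigmaSpace X ∧ IsMSpace X] := by
  -- The Hausdorff axiom turns pseudometrizability into metrizability.
  have metr : TopologicalSpace.PseudoMetrizableSpace X → TopologicalSpace.MetrizableSpace X :=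
    fun _ => inferInstance
  tfae_have 1 → 2 := fun _ => by
    obtain ⟨𝒩, hσ, ho, hb⟩ := exists_sigmaLocallyFinite_basis X
    exact ⟨⟨inferInstance, 𝒩, hσ, isCpNetwork_of_basis ho hb⟩,
      hasCountableFanTightness_of_firstCountable X⟩
  tfae_have 1 → 3 := fun _ => by
    obtain ⟨𝒩, hσ, ho, hb⟩ := exists_sigmaLocallyFinite_basis X
    exact ⟨⟨inferInstance, 𝒩, hσ, isKNetwork_of_basis ho hb⟩, inferInstance,
      hasPropertyAlphaFour_of_firstCountable X⟩
  tfae_have 1 → 4 := fun _ => by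
    obtain ⟨𝒩, hσ, ho, hb⟩ := exists_sigmaLocallyFinite_basis X
    exact ⟨⟨inferInstance, 𝒩, hσ, isCkNetwork_of_basis ho hb⟩, inferInstance,
      hasPropertyAlphaFour_of_firstCountable X⟩
  tfae_have 1 → 5 := fun _ => by
    obtain ⟨𝒩, hσ, ho, hb⟩ := exists_sigmaLocallyFinite_basis X
    exact ⟨⟨inferInstance, 𝒩, hσ, isCnNetwork_of_basis ho hb⟩, isMSpace_of_pseudoMetrizable X⟩
  tfae_have 2 → 1 := fun ⟨h, ht⟩ => metr (h.pseudoMetrizableSpace ht)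
  tfae_have 3 → 1 := fun ⟨h, _, hα⟩ => metr (h.pseudoMetrizableSpace hα)
  tfae_have 4 → 1 := fun ⟨h, _, hα⟩ => metr (h.pseudoMetrizableSpace hα)
  tfae_have 5 → 1 := fun ⟨h, hM⟩ => metr (h.pseudoMetrizableSpace hM)
  tfae_finish
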